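/- Let $R$ be an integral domain with quotient field $K$, let $X$ be an indeterminate over $R$, and let $*$ be a star operation of finite character on $R[X]$. The following statements are equivalent: (i) every upper to zero in $R[X]$ is $*$-maximal; (ii) $R$ is a UMT-domain and $t\text{-}\mathrm{Max}(R[X]) = *\text{-}\mathrm{Max}(R[X])$. Here, for a domain $A$ with quotient field $L$, $F(A)$ is the set of nonzero fractional ideals of $A$, and a star operation on $A$ is a map $F(A)\to F(A)$, $E\mapsto E^*$, such that for all $E,F\in F(A)$ and $0\neq a\in L$: $(aE)^*=aE^*$; $E\subseteq E^*$, and $E\subseteq F$ implies $E^*\subseteq F^*$; $E^{**}=E^*$; and $A^*=A$. It is of finite character if $E^*=\bigcup\{F^* : F\subseteq E \text{ a nonzero finitely generated } A\text{-submodule}\}$ for all $E\in F(A)$. A $*$-prime ideal is a nonzero prime ideal $P$ of $A$ with $P^*=P$, the $*$-maximal ideals are the maximal elements, with respect to inclusion, of the set of $*$-prime ideals, and $*\text{-}\mathrm{Max}(A)$ is the set of all of them. The $t$-operation is the star operation $E\mapsto E_t=\bigcup\{(F^{-1})^{-1} : F\subseteq E \text{ a nonzero finitely generated } A\text{-submodule}\}$,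 where $F^{-1}=\{x\in L : xF\subseteq A\}$; it is the largest star operation of finite character on $A$. An upper to zero in $R[X]$ is an ideal of the form $fK[X]\cap R[X]$ with $f\in K[X]$ irreducible, and $R$ is a UMT-domain if every upper to zero in $R[X]$ is $t$-maximal. -/

import Mathlib

open Polynomial
open scoped nonZeroDivisors

/-- A star operation on an integral domain `A` with quotient field `L`: a closure operation
`E ↦ E^*` on the nonzero fractional ideals of `A` with `(aE)^* = aE^*` for `0 ≠ a ∈ L` and
`A^* = A`.  As the type `FractionalIdeal A⁰ L` contains the zero module, the operation is extended
by the convention `0^* = 0`, which adds no information; a nonzero `E` has a nonzero `E^*`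
by `le_star`. -/
structure StarOperation (A L : Type*) [CommRing A] [IsDomain A] [Field L] [Algebra A L]
    [IsFractionRing A L] where
  /-- the map `E ↦ E^*` -/
  star : FractionalIdeal A⁰ L → FractionalIdeal A⁰ L
  star_zero : star 0 = 0
  star_one : star 1 = 1
  star_smul : ∀ (a : L), a ≠ 0 → ∀ E : FractionalIdeal A⁰ L,
    star (FractionalIdeal.spanSingleton A⁰ a * E) = FractionalIdeal.spanSingleton A⁰ a * star E
  le_star : ∀ E : FractionalIdeal A⁰ L, E ≤ star E
  star_mono : ∀ E F : FractionalIdeal A⁰ L, E ≤ F → star E ≤ star F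
  star_star : ∀ E : FractionalIdeal A⁰ L, star (star E) = star E

namespace StarOperation

variable {A L : Type*} [CommRing A] [IsDomain A] [Field L] [Algebra A L] [IsFractionRing A L]

/-- Finite character: `E^*` is the union of the `F^*`, where `F` runs over the nonzero finitely
generated submodules of `E`, for every nonzero fractional ideal `E`. -/
def IsFiniteCharacter (s : StarOperation A L) : Prop :=
  ∀ E : FractionalIdeal A⁰ L, E ≠ 0 → ∀ x : L, x ∈ s.star E ↔
    ∃ F : FractionalIdeal A⁰ L, F ≠ 0 ∧ (F : Submodule A L).FG ∧ F ≤ E ∧ x ∈ s.star F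

/-- A `*`-ideal: a nonzero integral ideal `I` with `I^* = I`. -/
def IsStarIdeal (s : StarOperation A L) (I : Ideal A) : Prop :=
  I ≠ ⊥ ∧ s.star (I : FractionalIdeal A⁰ L) = (I : FractionalIdeal A⁰ L)

/-- A `*`-prime ideal: a prime ideal that is a `*`-ideal. -/
def IsStarPrime (s : StarOperation A L) (P : Ideal A) : Prop :=
  P.IsPrime ∧ s.IsStarIdeal P

/-- `*`-Max(A): the set of `*`-maximal ideals, that is, of the `*`-prime ideals which are maximal
(with respect to inclusion) among the `*`-prime ideals. -/
def starMax (s : StarOperation A L) : Set (Ideal A) :=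
  {P | Maximal s.IsStarPrime P}

/-- The divisorial closure `E_v = (E⁻¹)⁻¹`, where `E⁻¹ = (A : E)`; here `0_v = 0`. -/
noncomputable def vClosure (E : FractionalIdeal A⁰ L) : FractionalIdeal A⁰ L := (E⁻¹)⁻¹

theorem vClosure_zero : vClosure (0 : FractionalIdeal A⁰ L) = 0 := by
  simp [vClosure, FractionalIdeal.inv_zero']

theorem vClosure_one : vClosure (1 : FractionalIdeal A⁰ L) = 1 := by
  simp [vClosure]

theorem inv_ne_zero_of_ne_zero {E : FractionalIdeal A⁰ L} (hE : E ≠ 0) : E⁻¹ ≠ 0 := by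
  obtain ⟨a, J, ha, rfl⟩ := FractionalIdeal.exists_eq_spanSingleton_mul E
  intro h
  have haL : algebraMap A L a ≠ 0 := by
    simpa using ha
  have h1 : algebraMap A L a ∈
      (FractionalIdeal.spanSingleton A⁰ (algebraMap A L a)⁻¹ * (J : FractionalIdeal A⁰ L))⁻¹ := by
    rw [FractionalIdeal.mem_inv_iff hE]
    intro y hy
    rw [FractionalIdeal.mem_singleton_mul] at hy
    obtain ⟨z, hz, rfl⟩ := hy
    rw [mul_inv_cancel_left₀ haL]
    exact FractionalIdeal.coeIdeal_le_one hz
  rw [h] at h1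
  exact haL (by simpa using h1)

theorem mem_vClosure_iff {E : FractionalIdeal A⁰ L} (hE : E ≠ 0) (x : L) :
    x ∈ vClosure E ↔ ∀ y ∈ E⁻¹, x * y ∈ (1 : FractionalIdeal A⁰ L) :=
  FractionalIdeal.mem_inv_iff (inv_ne_zero_of_ne_zero hE)

theorem le_vClosure (E : FractionalIdeal A⁰ L) : E ≤ vClosure E := by
  by_cases hE : E = 0
  · rw [hE]; exact FractionalIdeal.zero_le _
  · intro x hx
    refine (mem_vClosure_iff hE x).2 fun y hy => ?_
    rw [mul_comm]
    exact (FractionalIdeal.mem_inv_iff hE).1 hy x hx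

theorem vClosure_mono {E F : FractionalIdeal A⁰ L} (h : E ≤ F) : vClosure E ≤ vClosure F := by
  by_cases hE : E = 0
  · rw [hE, vClosure_zero]; exact FractionalIdeal.zero_le _
  · have hF : F ≠ 0 := fun h0 => hE (le_antisymm (h0 ▸ h) (FractionalIdeal.zero_le _))
    exact FractionalIdeal.inv_anti_mono (inv_ne_zero_of_ne_zero hF) (inv_ne_zero_of_ne_zero hE)
      (FractionalIdeal.inv_anti_mono hE hF h)

theorem vClosure_vClosure (E : FractionalIdeal A⁰ L) : vClosure (vClosure E) = vClosure E := by
  by_cases hE : E = 0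
  · rw [hE, vClosure_zero, vClosure_zero]
  · have h1 := inv_ne_zero_of_ne_zero hE
    refine le_antisymm ?_ (le_vClosure _)
    exact FractionalIdeal.inv_anti_mono h1
      (inv_ne_zero_of_ne_zero (inv_ne_zero_of_ne_zero h1)) (le_vClosure E⁻¹)

theorem vClosure_smul_le {a : L} (ha : a ≠ 0) (E : FractionalIdeal A⁰ L) :
    FractionalIdeal.spanSingleton A⁰ a * vClosure E ≤
      vClosure (FractionalIdeal.spanSingleton A⁰ a * E) := by
  by_cases hE : E = 0
  · simp [hE, vClosure_zero]
  · have haE : FractionalIdeal.spanSingleton A⁰ a * E ≠ 0 := by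
      intro h
      apply hE
      rw [← one_mul E, ← FractionalIdeal.spanSingleton_one, ← inv_mul_cancel₀ ha,
        ← FractionalIdeal.spanSingleton_mul_spanSingleton, mul_assoc, h, mul_zero]
    intro x hx
    rw [← FractionalIdeal.mem_coe, FractionalIdeal.mem_coe,
      FractionalIdeal.mem_singleton_mul] at hx
    obtain ⟨z, hz, rfl⟩ := hx
    refine (mem_vClosure_iff haE _).2 fun y hy => ?_
    rw [mul_right_comm, mul_comm]
    refine (mem_vClosure_iff hE z).1 hz _ ?_
    rw [FractionalIdeal.mem_inv_iff hE]
    intro w hw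
    rw [mul_right_comm, mul_comm]
    refine (FractionalIdeal.mem_inv_iff haE).1 hy _ ?_
    exact FractionalIdeal.mem_singleton_mul.2 ⟨w, hw, rfl⟩

/-- The underlying submodule of `E_t`: the union of the `F_v`, where `F` runs over the finitely
generated submodules of `E` (allowing `F = 0` only adds the element `0`). -/
noncomputable def tSubmodule (E : FractionalIdeal A⁰ L) : Submodule A L where
  carrier := {x | ∃ F : FractionalIdeal A⁰ L,
    (F : Submodule A L).FG ∧ F ≤ E ∧ x ∈ vClosure F}
  zero_mem' := ⟨0, by simp [Submodule.fg_bot], FractionalIdeal.zero_le _,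
    (vClosure (0 : FractionalIdeal A⁰ L)).val.zero_mem⟩
  add_mem' := by
    rintro x y ⟨F, hF, hFE, hx⟩ ⟨G, hG, hGE, hy⟩
    refine ⟨F ⊔ G, by simpa using hF.sup hG, sup_le hFE hGE, ?_⟩
    exact (vClosure (F ⊔ G)).val.add_mem (vClosure_mono le_sup_left hx)
      (vClosure_mono le_sup_right hy)
  smul_mem' := by
    rintro c x ⟨F, hF, hFE, hx⟩
    exact ⟨F, hF, hFE, (vClosure F).val.smul_mem c hx⟩

theorem tSubmodule_le (E : FractionalIdeal A⁰ L) :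
    tSubmodule E ≤ (vClosure E : Submodule A L) := by
  rintro x ⟨F, -, hFE, hx⟩
  exact vClosure_mono hFE hx

/-- The `t`-closure `E_t = ⋃ {F_v | F ⊆ E finitely generated}` as a fractional ideal. -/
noncomputable def tClosure (E : FractionalIdeal A⁰ L) : FractionalIdeal A⁰ L :=
  ⟨tSubmodule E, FractionalIdeal.isFractional_of_le (tSubmodule_le E)⟩

theorem mem_tClosure_iff {E : FractionalIdeal A⁰ L} {x : L} :
    x ∈ tClosure E ↔ ∃ F : FractionalIdeal A⁰ L,
      (F : Submodule A L).FG ∧ F ≤ E ∧ x ∈ vClosure F := Iff.rfl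

theorem tClosure_mono {E F : FractionalIdeal A⁰ L} (h : E ≤ F) : tClosure E ≤ tClosure F := by
  rintro x ⟨G, hG, hGE, hx⟩
  exact ⟨G, hG, hGE.trans h, hx⟩

theorem le_tClosure (E : FractionalIdeal A⁰ L) : E ≤ tClosure E := by
  intro x hx
  refine ⟨FractionalIdeal.spanSingleton A⁰ x, ?_, ?_, ?_⟩
  · rw [FractionalIdeal.coe_spanSingleton]
    exact Submodule.fg_span_singleton x
  · rw [FractionalIdeal.spanSingleton_le_iff_mem]
    exact hx
  · exact le_vClosure _ (FractionalIdeal.mem_spanSingleton_self _ x)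

theorem tClosure_le_vClosure (E : FractionalIdeal A⁰ L) : tClosure E ≤ vClosure E :=
  tSubmodule_le E

theorem vClosure_le_tClosure {F E : FractionalIdeal A⁰ L} (hF : (F : Submodule A L).FG)
    (h : F ≤ E) : vClosure F ≤ tClosure E := fun _ hx => ⟨F, hF, h, hx⟩

/-- A finitely generated submodule of `E_t` lies in `F_v` for one finitely generated `F ⊆ E`. -/
theorem exists_fg_of_le_tClosure {E : FractionalIdeal A⁰ L} {M : Submodule A L} (hM : M.FG)
    (h : M ≤ (tClosure E : Submodule A L)) : ∃ F : FractionalIdeal A⁰ L,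
      (F : Submodule A L).FG ∧ F ≤ E ∧ M ≤ (vClosure F : Submodule A L) := by
  induction M, hM using Submodule.fg_induction with
  | singleton x =>
    obtain ⟨F, hF, hFE, hx⟩ := h (Submodule.mem_span_singleton_self x)
    exact ⟨F, hF, hFE, (Submodule.span_singleton_le_iff_mem _ _).2 hx⟩
  | sup M N hM hN ihM ihN =>
    obtain ⟨F, hF, hFE, hMF⟩ := ihM (le_sup_left.trans h)
    obtain ⟨G, hG, hGE, hNG⟩ := ihN (le_sup_right.trans h)
    refine ⟨F ⊔ G, by simpa using hF.sup hG, sup_le hFE hGE, sup_le ?_ ?_⟩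
    · exact fun x hx => vClosure_mono le_sup_left (hMF hx)
    · exact fun x hx => vClosure_mono le_sup_right (hNG hx)

theorem tClosure_tClosure (E : FractionalIdeal A⁰ L) : tClosure (tClosure E) = tClosure E := by
  refine le_antisymm ?_ (le_tClosure _)
  rintro x ⟨F, hF, hFE, hx⟩
  obtain ⟨G, hG, hGE, hFG⟩ := exists_fg_of_le_tClosure hF hFE
  refine ⟨G, hG, hGE, ?_⟩
  have h1 : vClosure F ≤ vClosure (vClosure G) := vClosure_mono hFG
  rw [vClosure_vClosure] at h1
  exact h1 hx

theorem tClosure_smul_le {a : L} (ha : a ≠ 0) (E : FractionalIdeal A⁰ L) :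
    FractionalIdeal.spanSingleton A⁰ a * tClosure E ≤
      tClosure (FractionalIdeal.spanSingleton A⁰ a * E) := by
  intro x hx
  rw [← FractionalIdeal.mem_coe, FractionalIdeal.mem_coe,
    FractionalIdeal.mem_singleton_mul] at hx
  obtain ⟨z, ⟨F, hF, hFE, hz⟩, rfl⟩ := hx
  refine ⟨FractionalIdeal.spanSingleton A⁰ a * F, ?_, by gcongr, ?_⟩
  · rw [FractionalIdeal.coe_mul, FractionalIdeal.coe_spanSingleton]
    exact (Submodule.fg_span_singleton a).mul hF
  · exact vClosure_smul_le ha F (FractionalIdeal.mem_singleton_mul.2 ⟨z, hz, rfl⟩)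

theorem tClosure_smul {a : L} (ha : a ≠ 0) (E : FractionalIdeal A⁰ L) :
    tClosure (FractionalIdeal.spanSingleton A⁰ a * E) =
      FractionalIdeal.spanSingleton A⁰ a * tClosure E := by
  refine le_antisymm ?_ (tClosure_smul_le ha E)
  have h := tClosure_smul_le (inv_ne_zero ha) (FractionalIdeal.spanSingleton A⁰ a * E)
  rw [← mul_assoc, FractionalIdeal.spanSingleton_mul_spanSingleton, inv_mul_cancel₀ ha,
    FractionalIdeal.spanSingleton_one, one_mul] at h
  calc tClosure (FractionalIdeal.spanSingleton A⁰ a * E)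
      = FractionalIdeal.spanSingleton A⁰ a * (FractionalIdeal.spanSingleton A⁰ a⁻¹ *
          tClosure (FractionalIdeal.spanSingleton A⁰ a * E)) := by
        rw [← mul_assoc, FractionalIdeal.spanSingleton_mul_spanSingleton, mul_inv_cancel₀ ha,
          FractionalIdeal.spanSingleton_one, one_mul]
    _ ≤ _ := by gcongr

variable (A L) in
/-- The `t`-operation on `A`, as a star operation. -/
noncomputable def tOperation : StarOperation A L where
  star := tClosure
  star_zero := by
    refine le_antisymm ?_ (FractionalIdeal.zero_le _)
    have h := tClosure_le_vClosure (0 : FractionalIdeal A⁰ L)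
    rwa [vClosure_zero] at h
  star_one := by
    refine le_antisymm ?_ (le_tClosure _)
    have h := tClosure_le_vClosure (1 : FractionalIdeal A⁰ L)
    rwa [vClosure_one] at h
  star_smul _ ha E := tClosure_smul ha E
  le_star := le_tClosure
  star_mono _ _ h := tClosure_mono h
  star_star := tClosure_tClosure

/-- The `t`-operation is of finite character. -/
theorem tOperation_isFiniteCharacter : (tOperation A L).IsFiniteCharacter := by
  intro E hE x
  constructor
  · rintro ⟨F, hF, hFE, hx⟩
    by_cases h0 : F = 0
    · obtain ⟨y, hy, hy0⟩ : ∃ y ∈ E, y ≠ 0 := by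
        by_contra! h
        exact hE (FractionalIdeal.eq_zero_iff.2 h)
      refine ⟨FractionalIdeal.spanSingleton A⁰ y, FractionalIdeal.spanSingleton_ne_zero_iff.2 hy0, ?_, ?_, ?_⟩
      · rw [FractionalIdeal.coe_spanSingleton]
        exact Submodule.fg_span_singleton y
      · rw [FractionalIdeal.spanSingleton_le_iff_mem]
        exact hy
      · rw [h0, vClosure_zero, FractionalIdeal.mem_zero_iff] at hx
        rw [hx]
        exact (tClosure (FractionalIdeal.spanSingleton A⁰ y)).val.zero_mem
    · exact ⟨F, h0, hF, hFE, F, hF, le_rfl, hx⟩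
  · rintro ⟨F, -, -, hFE, hx⟩
    exact tClosure_mono hFE hx

/-- The `t`-operation is the largest star operation of finite character. -/
theorem IsFiniteCharacter.star_le_tOperation {s : StarOperation A L} (hs : s.IsFiniteCharacter)
    (E : FractionalIdeal A⁰ L) : s.star E ≤ (tOperation A L).star E := by
  by_cases hE : E = 0
  · rw [hE, s.star_zero]; exact FractionalIdeal.zero_le _
  intro x hx
  obtain ⟨F, hF0, hF, hFE, hxF⟩ := (hs E hE x).1 hx
  refine ⟨F, hF, hFE, (mem_vClosure_iff hF0 x).2 fun y hy => ?_⟩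
  by_cases hy0 : y = 0
  · rw [hy0, mul_zero]; exact (1 : FractionalIdeal A⁰ L).val.zero_mem
  have h1 : FractionalIdeal.spanSingleton A⁰ y * F ≤ 1 := by
    rw [FractionalIdeal.spanSingleton_mul_le_iff]
    exact (FractionalIdeal.mem_inv_iff hF0).1 hy
  have h2 := s.star_mono _ _ h1
  rw [s.star_one, s.star_smul y hy0, FractionalIdeal.spanSingleton_mul_le_iff] at h2
  rw [mul_comm]
  exact h2 x hxF

end StarOperation

/-- An upper to zero in `R[X]`: an ideal `fK[X] ∩ R[X]` with `f ∈ K[X]` irreducible, where `K` is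
the quotient field of `R`. -/
def IsUpperToZero {R : Type*} (K : Type*) [CommRing R] [IsDomain R] [Field K] [Algebra R K]
    [IsFractionRing R K] (Q : Ideal R[X]) : Prop :=
  ∃ f : K[X], Irreducible f ∧ Q = (Ideal.span {f}).comap (mapRingHom (algebraMap R K))

/-- `R` is a UMT-domain: every upper to zero in `R[X]` is `t`-maximal.  Here `K` and `L` are
the quotient fields of `R` and of `R[X]`. -/
def IsUMTDomain (R K L : Type*) [CommRing R] [IsDomain R] [Field K] [Algebra R K]
    [IsFractionRing R K] [Field L] [Algebra R[X] L] [IsFractionRing R[X] L] : Prop :=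
  ∀ Q : Ideal R[X], IsUpperToZero K Q → Q ∈ (StarOperation.tOperation R[X] L).starMax

/-!
The content is in the implication from "every upper to zero is `*`-maximal". A `t`-ideal is a
`*`-ideal for every `*` of finite character, and uppers to zero are always `t`-ideals: with `f`
chosen in `R[X]`, a finite subset of `fK[X] ∩ R[X]` is carried into the principal ideal `f R[X]` by one nonzero constant, and
principal ideals are divisorial (`IsUpperToZero.mem_of_mem_tClosure`). Hence uppers to zero which
are `*`-maximal are `t`-maximal, and `R` is a UMT-domain.

It remains to see that a `*`-maximal ideal `N` is a `t`-ideal. If not, then `N_t = R[X]`, because a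
proper `t`-ideal lies in some `*`-maximal ideal, which for `N_t` can only be `N`. So a finite subset of `N` has trivial
divisorial closure; spreading its members out by powers of `X` yields a single `g ∈ N` whose
content ideal has inverse `R` (`exists_mem_span_coeff`). A McCoy-type induction
(`mem_liftsRing_of_mul_mem`, `dvd_of_map_dvd_map`) gives `gK[X] ∩ R[X] = g R[X] ⊆ N`, and
factoring `g` in `K[X]` shows that the prime `N` contains an upper to zero (`exists_isUpperToZero_le`). By hypothesis that
upper is `*`-maximal, so it equals `N`, and `N` is a `t`-ideal after all.
-/

/-! ### Star ideals and star-maximal ideals -/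

namespace StarOperation

variable {A L : Type*} [CommRing A] [IsDomain A] [Field L] [Algebra A L] [IsFractionRing A L]

theorem isStarIdeal_of_star_le {s : StarOperation A L} {I : Ideal A} (h0 : I ≠ ⊥)
    (h : ∀ x : A, algebraMap A L x ∈ s.star (I : FractionalIdeal A⁰ L) → x ∈ I) :
    s.IsStarIdeal I := by
  refine ⟨h0, le_antisymm (fun x hx => ?_) (s.le_star _)⟩
  have h1 : s.star (I : FractionalIdeal A⁰ L) ≤ 1 := by
    rw [← s.star_one]
    exact s.star_mono _ _ FractionalIdeal.coeIdeal_le_one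
  obtain ⟨y, rfl⟩ := (FractionalIdeal.mem_one_iff A⁰).1 (h1 hx)
  exact FractionalIdeal.mem_coeIdeal_of_mem A⁰ (h y hx)

theorem IsStarIdeal.mem_of_mem_star {s : StarOperation A L} {I : Ideal A} (hI : s.IsStarIdeal I)
    {x : A} (hx : algebraMap A L x ∈ s.star (I : FractionalIdeal A⁰ L)) : x ∈ I := by
  rw [hI.2] at hx
  obtain ⟨y, hy, hxy⟩ := (FractionalIdeal.mem_coeIdeal A⁰).1 hx
  rwa [← IsFractionRing.injective A L hxy]

theorem IsFiniteCharacter.isStarIdeal_of_tOperation {s : StarOperation A L}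
    (hs : s.IsFiniteCharacter) {I : Ideal A} (hI : (tOperation A L).IsStarIdeal I) :
    s.IsStarIdeal I :=
  isStarIdeal_of_star_le hI.1 fun _ hx => hI.mem_of_mem_star (hs.star_le_tOperation _ hx)

/-- The closure of a nonzero ideal is again an integral ideal, and a star ideal. -/
theorem exists_isStarIdeal_star_eq (s : StarOperation A L) {I : Ideal A} (hI : I ≠ ⊥) :
    ∃ J : Ideal A, I ≤ J ∧ s.IsStarIdeal J ∧
      (J : FractionalIdeal A⁰ L) = s.star (I : FractionalIdeal A⁰ L) := by
  have h1 : s.star (I : FractionalIdeal A⁰ L) ≤ 1 := by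
    rw [← s.star_one]
    exact s.star_mono _ _ FractionalIdeal.coeIdeal_le_one
  obtain ⟨J, hJ⟩ := FractionalIdeal.le_one_iff_exists_coeIdeal.1 h1
  have hIJ : I ≤ J := by
    rw [← FractionalIdeal.coeIdeal_le_coeIdeal L, hJ]
    exact s.le_star _
  exact ⟨J, hIJ, ⟨ne_bot_of_le_ne_bot hI hIJ, by rw [hJ, s.star_star]⟩, hJ⟩

/-- The union of a chain of star ideals is a star ideal, for a star operation of finite
character. -/
theorem IsFiniteCharacter.isStarIdeal_sSup {s : StarOperation A L} (hs : s.IsFiniteCharacter)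
    {c : Set (Ideal A)} (hne : c.Nonempty) (hc : IsChain (· ≤ ·) c)
    (h : ∀ I ∈ c, s.IsStarIdeal I) : s.IsStarIdeal (sSup c) := by
  obtain ⟨I₀, hI₀⟩ := hne
  have hbot : sSup c ≠ ⊥ := ne_bot_of_le_ne_bot (h I₀ hI₀).1 (le_sSup hI₀)
  refine isStarIdeal_of_star_le hbot fun x hx => ?_
  obtain ⟨F, -, hFG, hFle, hxF⟩ :=
    (hs _ (FractionalIdeal.coeIdeal_ne_zero.2 hbot) _).1 hx
  obtain ⟨J, rfl⟩ := FractionalIdeal.le_one_iff_exists_coeIdeal.1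
    (hFle.trans FractionalIdeal.coeIdeal_le_one)
  have hJ : J.FG := (FractionalIdeal.coeIdeal_fg A⁰ (IsFractionRing.injective A L) J).1 hFG
  have hJc : J ≤ sSup c := (FractionalIdeal.coeIdeal_le_coeIdeal L).1 hFle
  -- a finitely generated ideal is a compact element, so one member of the chain contains it
  obtain ⟨I, hI, hJI⟩ := (CompleteLattice.isCompactElement_iff_le_of_directed_sSup_le _ _).1
    ((Submodule.fg_iff_compact J).1 hJ) c ⟨I₀, hI₀⟩ hc.directedOn hJc
  exact le_sSup hI ((h I hI).mem_of_mem_star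
    (s.star_mono _ _ ((FractionalIdeal.coeIdeal_le_coeIdeal L).2 hJI) hxF))

/-- An ideal which is maximal among the proper star ideals is prime. -/
theorem isPrime_of_maximal_isStarIdeal {s : StarOperation A L} {M : Ideal A}
    (hM : Maximal (fun I => s.IsStarIdeal I ∧ I ≠ ⊤) M) : M.IsPrime := by
  refine ⟨hM.prop.2, fun {a b} hab => or_iff_not_imp_left.2 fun ha => ?_⟩
  by_cases hb0 : b = 0
  · rw [hb0]; exact M.zero_mem
  have hlt : M ≤ M ⊔ Ideal.span {a} := le_sup_left
  obtain ⟨J, hIJ, hJ, hJeq⟩ :=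
    s.exists_isStarIdeal_star_eq (ne_bot_of_le_ne_bot hM.prop.1.1 hlt)
  have hJtop : J = ⊤ := by
    by_contra hne
    exact ha (hM.le_of_ge ⟨hJ, hne⟩ (hlt.trans hIJ)
      (hIJ (le_sup_right (a := M) (Ideal.mem_span_singleton_self a))))
  -- now `b ∈ b (M + aA)^* = (bM + abA)^* ⊆ M^* = M`
  have hle : FractionalIdeal.spanSingleton A⁰ (algebraMap A L b) *
      ((M ⊔ Ideal.span {a} : Ideal A) : FractionalIdeal A⁰ L) ≤ (M : FractionalIdeal A⁰ L) := by
    rw [← FractionalIdeal.coeIdeal_span_singleton, ← FractionalIdeal.coeIdeal_mul,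
      FractionalIdeal.coeIdeal_le_coeIdeal, Ideal.mul_sup,
      Ideal.span_singleton_mul_span_singleton]
    refine sup_le Ideal.mul_le_right ?_
    rw [Ideal.span_singleton_le_iff_mem, mul_comm]
    exact hab
  have hstar := s.star_mono _ _ hle
  rw [s.star_smul _ (by simpa using hb0), ← hJeq, hJtop, FractionalIdeal.coeIdeal_top,
    mul_one, FractionalIdeal.spanSingleton_le_iff_mem] at hstar
  exact hM.prop.1.mem_of_mem_star hstar

theorem IsFiniteCharacter.exists_le_mem_starMax {s : StarOperation A L}
    (hs : s.IsFiniteCharacter) {I : Ideal A} (hI : s.IsStarIdeal I) (htop : I ≠ ⊤) :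
    ∃ M ∈ s.starMax, I ≤ M := by
  obtain ⟨M, hIM, hM⟩ := zorn_le_nonempty₀ {J | s.IsStarIdeal J ∧ J ≠ ⊤}
    (fun c hcs hc J hJ => by
      refine ⟨sSup c, ⟨hs.isStarIdeal_sSup ⟨J, hJ⟩ hc fun I hI => (hcs hI).1, fun h => ?_⟩,
        fun _ => le_sSup⟩
      rw [Ideal.eq_top_iff_one, Submodule.mem_sSup_of_directed ⟨J, hJ⟩ hc.directedOn] at h
      obtain ⟨I, hIc, h1⟩ := h
      exact (hcs hIc).2 ((Ideal.eq_top_iff_one I).2 h1))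
    I ⟨hI, htop⟩
  have hM' : Maximal (fun I => s.IsStarIdeal I ∧ I ≠ ⊤) M := hM
  exact ⟨M, ⟨⟨isPrime_of_maximal_isStarIdeal hM', hM'.prop.1⟩,
    fun P hP hMP => hM'.le_of_ge ⟨hP.2, hP.1.ne_top⟩ hMP⟩, hIM⟩

/-- Membership in the divisorial closure of an ideal, phrased by divisibility: the fraction `c / b`
lies in the inverse of the ideal exactly when `b` divides all the `c * h`. -/
theorem dvd_mul_of_mem_vClosure {I : Ideal A} {x b c : A}
    (hx : algebraMap A L x ∈ vClosure (I : FractionalIdeal A⁰ L)) (hb : b ≠ 0)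
    (h : ∀ y ∈ I, b ∣ c * y) : b ∣ c * x := by
  by_cases hI : (I : FractionalIdeal A⁰ L) = 0
  · rw [hI, vClosure_zero, FractionalIdeal.mem_zero_iff, map_eq_zero_iff _
      (IsFractionRing.injective A L)] at hx
    simp [hx]
  have hbL : algebraMap A L b ≠ 0 := by simpa using hb
  have hinv : algebraMap A L c / algebraMap A L b ∈ (I : FractionalIdeal A⁰ L)⁻¹ := by
    rw [FractionalIdeal.mem_inv_iff hI]
    intro y hy
    obtain ⟨y, hyI, rfl⟩ := (FractionalIdeal.mem_coeIdeal A⁰).1 hy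
    obtain ⟨z, hz⟩ := h y hyI
    refine (FractionalIdeal.mem_one_iff A⁰).2 ⟨z, ?_⟩
    rw [div_mul_eq_mul_div, eq_div_iff hbL, ← map_mul, ← map_mul, hz, mul_comm]
  obtain ⟨z, hz⟩ := (FractionalIdeal.mem_one_iff A⁰).1 ((mem_vClosure_iff hI _).1 hx _ hinv)
  refine ⟨z, IsFractionRing.injective A L ?_⟩
  rw [map_mul, map_mul, hz]
  field_simp

/-- An integral element of the `t`-closure of an ideal lies in the divisorial closure of
finitely many elements of the ideal. -/
theorem exists_finset_of_mem_tClosure {I : Ideal A} {x : A}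
    (hx : algebraMap A L x ∈ tClosure (I : FractionalIdeal A⁰ L)) :
    ∃ S : Finset A, (S : Set A) ⊆ I ∧
      ∀ b c : A, b ≠ 0 → (∀ y ∈ S, b ∣ c * y) → b ∣ c * x := by
  obtain ⟨F, hFG, hFle, hxF⟩ := mem_tClosure_iff.1 hx
  obtain ⟨J, rfl⟩ := FractionalIdeal.le_one_iff_exists_coeIdeal.1
    (hFle.trans FractionalIdeal.coeIdeal_le_one)
  obtain ⟨S, rfl⟩ := (FractionalIdeal.coeIdeal_fg A⁰ (IsFractionRing.injective A L) J).1 hFG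
  refine ⟨S, Ideal.span_le.1 ((FractionalIdeal.coeIdeal_le_coeIdeal L).1 hFle),
    fun b c hb h => dvd_mul_of_mem_vClosure hxF hb fun y hy => ?_⟩
  induction hy using Submodule.span_induction with
  | mem y hy => exact h y hy
  | zero => simp
  | add y z _ _ hy hz => rw [mul_add]; exact dvd_add hy hz
  | smul a y _ hy => rw [smul_eq_mul, mul_left_comm]; exact hy.mul_left a

end StarOperation

/-! ### Contents of polynomials -/

/-- The ideal generated by finitely many polynomials contains one whose coefficients include all
of theirs: add up the members shifted by powers of `X` large enough that they do not overlap. -/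
theorem exists_mem_span_coeff {R : Type*} [CommRing R] (S : Finset R[X]) :
    ∃ g ∈ Ideal.span (S : Set R[X]), ∀ h ∈ S, ∀ i, ∃ j, g.coeff j = h.coeff i := by
  classical
  induction S using Finset.induction_on with
  | empty => exact ⟨0, by simp, by simp⟩
  | insert h S _ ih =>
    obtain ⟨g, hg, hcoeff⟩ := ih
    refine ⟨g + h * X ^ (g.natDegree + 1), ?_, ?_⟩
    · refine add_mem (Ideal.span_mono (by simp) hg) (Ideal.mul_mem_right _ _ ?_)
      exact Ideal.subset_span (by simp)
    · have hlow : ∀ j ≤ g.natDegree,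
          (g + h * X ^ (g.natDegree + 1)).coeff j = g.coeff j := fun j hj => by
        rw [coeff_add, coeff_mul_X_pow', if_neg (by omega), add_zero]
      have hhigh : ∀ i,
          (g + h * X ^ (g.natDegree + 1)).coeff (i + (g.natDegree + 1)) = h.coeff i := fun i => by
        rw [coeff_add, coeff_mul_X_pow, coeff_eq_zero_of_natDegree_lt (by omega), zero_add]
      intro h' hh' i
      rcases Finset.mem_insert.1 hh' with rfl | hh'
      · exact ⟨_, hhigh i⟩
      · obtain ⟨j, hj⟩ := hcoeff h' hh' i
        by_cases hjg : j ≤ g.natDegree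
        · exact ⟨j, (hlow j hjg).trans hj⟩
        · -- the coefficient is `0`, which also occurs beyond the degree of `h`
          refine ⟨_, (hhigh (h.natDegree + 1)).trans ?_⟩
          rw [← hj, coeff_eq_zero_of_natDegree_lt (by omega),
            coeff_eq_zero_of_natDegree_lt (by omega)]

/-- A form of McCoy's theorem for the `R`-module `K / R`: if no element of `K` outside `R`
multiplies all coefficients of `g` into `R`, then no polynomial over `K` outside `R[X]` multiplies
`g` into `R[X]`. -/
theorem mem_liftsRing_of_mul_mem {R K : Type*} [CommRing R] [CommRing K] [Algebra R K]
    {g : R[X]}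
    (hg : ∀ a : K, (∀ i, algebraMap R K (g.coeff i) * a ∈ Set.range (algebraMap R K)) →
      a ∈ Set.range (algebraMap R K))
    {k : K[X]} (hk : g.map (algebraMap R K) * k ∈ liftsRing (algebraMap R K)) :
    k ∈ liftsRing (algebraMap R K) := by
  have hiff : ∀ p : K[X], p ∈ liftsRing (algebraMap R K) ↔
      ∀ n, p.coeff n ∈ (algebraMap R K).range := fun p => by
    rw [← lifts_iff_liftsRing, lifts_iff_coeff_lifts]; rfl
  induction hn : k.support.card using Nat.strong_induction_on generalizing k with
  | _ n ih =>
    -- descending induction on `i`: each coefficient of `g` multiplies `k` into `R[X]`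
    have H : ∀ m i, g.natDegree < i + m →
        C (algebraMap R K (g.coeff i)) * k ∈ liftsRing (algebraMap R K) := by
      intro m
      induction m with
      | zero =>
        intro i hi
        rw [coeff_eq_zero_of_natDegree_lt (by omega)]
        simp [zero_mem]
      | succ m ihm =>
        intro i hi
        by_cases hk0 : k = 0
        · simp [hk0, zero_mem]
        -- the coefficient of `g * k` in degree `i + deg k` is `gᵢ * lead k` modulo `R`
        have hlead : algebraMap R K (g.coeff i) * k.leadingCoeff ∈ (algebraMap R K).range := by
          have hmul := (hiff _).1 hk (i + k.natDegree)
          rw [coeff_mul, ← Finset.add_sum_erase _ _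
            (Finset.HasAntidiagonal.mem_antidiagonal (a := (i, k.natDegree)).2 rfl),
            coeff_map] at hmul
          refine (add_mem_cancel_right (sum_mem fun p hp => ?_)).1 hmul
          rw [Finset.mem_erase, Finset.HasAntidiagonal.mem_antidiagonal, Ne, Prod.ext_iff] at hp
          rcases lt_or_ge i p.1 with h | h
          · have := (hiff _).1 (ihm p.1 (by omega)) p.2
            rwa [coeff_C_mul, ← coeff_map] at this
          · rw [coeff_eq_zero_of_natDegree_lt (p := k) (n := p.2) (by grind), mul_zero]
            exact zero_mem _
        have hmono : C (algebraMap R K (g.coeff i)) * monomial k.natDegree k.leadingCoeff ∈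
            liftsRing (algebraMap R K) := by
          rw [C_mul_monomial, ← lifts_iff_liftsRing]
          exact monomial_mem_lifts _ hlead
        have herase : C (algebraMap R K (g.coeff i)) * k.eraseLead ∈
            liftsRing (algebraMap R K) := by
          refine ih _ ?_ ?_ rfl
          · refine lt_of_le_of_lt (Finset.card_le_card fun j hj => ?_)
              (hn ▸ eraseLead_support_card_lt hk0)
            rw [mem_support_iff, coeff_C_mul] at hj
            exact mem_support_iff.2 (right_ne_zero_of_mul hj)
          · have hC : C (algebraMap R K (g.coeff i)) ∈ liftsRing (algebraMap R K) :=
              (lifts_iff_liftsRing _ _).1 (C_mem_lifts _ _)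
            have hgl : g.map (algebraMap R K) ∈ liftsRing (algebraMap R K) :=
              (lifts_iff_liftsRing _ _).1 ((mem_lifts _).2 ⟨g, rfl⟩)
            have h3 : g.map (algebraMap R K) * (C (algebraMap R K (g.coeff i)) * k.eraseLead) =
                C (algebraMap R K (g.coeff i)) * (g.map (algebraMap R K) * k) -
                g.map (algebraMap R K) * (C (algebraMap R K (g.coeff i)) *
                  monomial k.natDegree k.leadingCoeff) := by
              rw [← self_sub_monomial_natDegree_leadingCoeff]
              ring
            rw [h3]
            exact sub_mem (mul_mem hC hk) (mul_mem hgl hmono)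
        rw [← eraseLead_add_monomial_natDegree_leadingCoeff k, mul_add]
        exact add_mem herase hmono
    refine (hiff k).2 fun j => hg _ fun i => ?_
    have := (hiff _).1 (H (g.natDegree + 1) i (by omega)) j
    rwa [coeff_C_mul] at this

/-- If the content ideal of `g ∈ R[X]` has inverse `R`, then `gK[X] ∩ R[X] = g R[X]`. -/
theorem dvd_of_map_dvd_map {R K : Type*} [CommRing R] [IsDomain R] [Field K] [Algebra R K]
    [IsFractionRing R K] {g h : R[X]}
    (hg : ∀ b c : R, b ≠ 0 → (∀ i, b ∣ c * g.coeff i) → b ∣ c)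
    (hgh : g.map (algebraMap R K) ∣ h.map (algebraMap R K)) : g ∣ h := by
  obtain ⟨k, hk⟩ := hgh
  have hinj : Function.Injective (algebraMap R K) := IsFractionRing.injective R K
  have hmem : k ∈ liftsRing (algebraMap R K) := by
    refine mem_liftsRing_of_mul_mem (g := g) (fun a ha => ?_) ?_
    · obtain ⟨c, b, hb, rfl⟩ := IsFractionRing.div_surjective (A := R) a
      have hb0 : b ≠ 0 := nonZeroDivisors.ne_zero hb
      have hbK : algebraMap R K b ≠ 0 := by simpa using hb0
      obtain ⟨d, rfl⟩ := hg b c hb0 fun i => by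
        obtain ⟨r, hr⟩ := ha i
        refine ⟨r, hinj ?_⟩
        rw [map_mul, map_mul, hr]
        field_simp
      exact ⟨d, by rw [map_mul, mul_div_cancel_left₀ _ hbK]⟩
    · rw [← hk, ← lifts_iff_liftsRing]
      exact (mem_lifts _).2 ⟨h, rfl⟩
  obtain ⟨q, rfl⟩ := (mem_lifts _).1 ((lifts_iff_liftsRing _ _).2 hmem)
  exact ⟨q, map_injective _ hinj (by rw [hk, Polynomial.map_mul])⟩

/-! ### Uppers to zero -/

section UpperToZero

variable {R K L : Type*} [CommRing R] [IsDomain R] [Field K] [Algebra R K] [IsFractionRing R K]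
  [Field L] [Algebra R[X] L] [IsFractionRing R[X] L]

theorem exists_dvd_C_mul_of_map_dvd_map {f h : R[X]}
    (hfh : f.map (algebraMap R K) ∣ h.map (algebraMap R K)) : ∃ d : R, d ≠ 0 ∧ f ∣ C d * h := by
  obtain ⟨q, hq⟩ := hfh
  obtain ⟨b, hb, hbq⟩ := IsLocalization.integerNormalization_spec R⁰ q
  refine ⟨b, nonZeroDivisors.ne_zero hb, IsLocalization.integerNormalization R⁰ q,
    map_injective _ (IsFractionRing.injective R K) ?_⟩
  rw [Polynomial.map_mul, Polynomial.map_mul, hbq, hq, map_C, Algebra.smul_def,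
    Polynomial.algebraMap_apply]
  simp only [mul_left_comm]

/-- The irreducible polynomial defining an upper to zero may be taken in `R[X]`. -/
theorem IsUpperToZero.exists_mem_iff {Q : Ideal R[X]} (hQ : IsUpperToZero K Q) :
    ∃ f : R[X], Irreducible (f.map (algebraMap R K)) ∧
      ∀ h, h ∈ Q ↔ f.map (algebraMap R K) ∣ h.map (algebraMap R K) := by
  obtain ⟨f, hf, rfl⟩ := hQ
  obtain ⟨b, hb, hbf⟩ := IsLocalization.integerNormalization_spec R⁰ f
  have hass : Associated f ((IsLocalization.integerNormalization R⁰ f).map (algebraMap R K)) := by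
    rw [hbf, Algebra.smul_def, Polynomial.algebraMap_apply]
    refine (associated_unit_mul_left f _ (isUnit_C.2 (isUnit_iff_ne_zero.2 ?_))).symm
    simpa using nonZeroDivisors.ne_zero hb
  refine ⟨_, hass.irreducible hf, fun h => ?_⟩
  rw [← hass.dvd_iff_dvd_left, Ideal.mem_comap, Ideal.mem_span_singleton, coe_mapRingHom]

theorem IsUpperToZero.isPrime {Q : Ideal R[X]} (hQ : IsUpperToZero K Q) : Q.IsPrime := by
  obtain ⟨f, hf, rfl⟩ := hQ
  have := (Ideal.span_singleton_prime hf.ne_zero).2 hf.prime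
  exact Ideal.comap_isPrime _ _

theorem IsUpperToZero.ne_bot {Q : Ideal R[X]} (hQ : IsUpperToZero K Q) : Q ≠ ⊥ := by
  obtain ⟨f, hf, hmem⟩ := hQ.exists_mem_iff
  rintro rfl
  refine hf.ne_zero ?_
  rw [(Submodule.mem_bot _).1 ((hmem f).2 dvd_rfl), Polynomial.map_zero]

/-- An upper to zero is a `t`-ideal: finitely many of its elements are carried by one nonzero
constant into a principal ideal, which is divisorial. -/
theorem IsUpperToZero.mem_of_mem_tClosure {Q : Ideal R[X]} (hQ : IsUpperToZero K Q) {x : R[X]}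
    (hx : algebraMap R[X] L x ∈ StarOperation.tClosure (Q : FractionalIdeal R[X]⁰ L)) :
    x ∈ Q := by
  obtain ⟨f, hf, hmem⟩ := hQ.exists_mem_iff
  obtain ⟨S, hSQ, hS⟩ := StarOperation.exists_finset_of_mem_tClosure hx
  have hex : ∀ h : R[X], ∃ d : R, d ≠ 0 ∧ (h ∈ S → f ∣ C d * h) := fun h => by
    by_cases hh : h ∈ S
    · obtain ⟨d, hd, hdvd⟩ := exists_dvd_C_mul_of_map_dvd_map ((hmem h).1 (hSQ hh))
      exact ⟨d, hd, fun _ => hdvd⟩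
    · exact ⟨1, one_ne_zero, fun h => absurd h hh⟩
  choose d hd hdvd using hex
  have hf0 : f ≠ 0 := by
    rintro rfl
    exact hf.ne_zero (Polynomial.map_zero _)
  have hfx := hS f (C (∏ h ∈ S, d h)) hf0 fun y hy => (hdvd y hy).trans
    (mul_dvd_mul_right (map_dvd C (Finset.dvd_prod_of_mem d hy)) y)
  have hunit : IsUnit (C (algebraMap R K (∏ h ∈ S, d h))) :=
    isUnit_C.2 (isUnit_iff_ne_zero.2 (by simpa [Finset.prod_eq_zero_iff] using fun h _ => hd h))
  have := Polynomial.map_dvd (algebraMap R K) hfx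
  rw [Polynomial.map_mul, map_C, hunit.dvd_mul_left] at this
  exact (hmem x).2 this

theorem IsUpperToZero.isStarPrime_tOperation {Q : Ideal R[X]} (hQ : IsUpperToZero K Q) :
    (StarOperation.tOperation R[X] L).IsStarPrime Q :=
  ⟨hQ.isPrime, StarOperation.isStarIdeal_of_star_le hQ.ne_bot fun _ => hQ.mem_of_mem_tClosure⟩

/-- A prime ideal of `R[X]` containing the contraction of a nonzero ideal of `K[X]` contains an
upper to zero. -/
theorem exists_isUpperToZero_le {N : Ideal R[X]} (hN : N.IsPrime) {p : K[X]} (hp : p ≠ 0)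
    (hle : (Ideal.span {p}).comap (mapRingHom (algebraMap R K)) ≤ N) :
    ∃ Q : Ideal R[X], IsUpperToZero K Q ∧ Q ≤ N := by
  induction p using WfDvdMonoid.induction_on_irreducible with
  | zero => exact absurd rfl hp
  | unit u hu =>
    rw [Ideal.span_singleton_eq_top.2 hu, Ideal.comap_top] at hle
    exact absurd (top_le_iff.1 hle) hN.ne_top
  | mul p f hp0 hf ih =>
    have hmul := (Ideal.le_comap_mul (mapRingHom (algebraMap R K)) (K := Ideal.span {f})
      (L := Ideal.span {p})).trans ((Ideal.span_singleton_mul_span_singleton f p).symm ▸ hle)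
    rcases hN.mul_le.1 hmul with h | h
    · exact ⟨_, ⟨f, hf, rfl⟩, h⟩
    · exact ih hp0 h

/-- If every upper to zero is `*`-maximal, then every `*`-maximal ideal is a `t`-ideal. -/
theorem isStarIdeal_tOperation_of_mem_starMax {s : StarOperation R[X] L}
    (hs : s.IsFiniteCharacter) (h : ∀ Q : Ideal R[X], IsUpperToZero K Q → Q ∈ s.starMax)
    {N : Ideal R[X]} (hN : N ∈ s.starMax) : (StarOperation.tOperation R[X] L).IsStarIdeal N := by
  have hmax : Maximal s.IsStarPrime N := hN
  obtain ⟨J, hNJ, hJ, hJeq⟩ :=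
    (StarOperation.tOperation R[X] L).exists_isStarIdeal_star_eq hmax.prop.2.1
  by_cases hJtop : J = ⊤
  · have h1 : algebraMap R[X] L 1 ∈ StarOperation.tClosure (N : FractionalIdeal R[X]⁰ L) := by
      have h2 : StarOperation.tClosure (N : FractionalIdeal R[X]⁰ L) = 1 := by
        rw [← FractionalIdeal.coeIdeal_top, ← hJtop]
        exact hJeq.symm
      rw [h2, map_one]
      exact FractionalIdeal.one_mem_one _
    obtain ⟨S, hSN, hS⟩ := StarOperation.exists_finset_of_mem_tClosure h1
    obtain ⟨g, hgS, hcoeff⟩ := exists_mem_span_coeff S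
    have hgN : g ∈ N := Ideal.span_le.2 hSN hgS
    have hcont : ∀ b c : R, b ≠ 0 → (∀ i, b ∣ c * g.coeff i) → b ∣ c := fun b c hb hbc => by
      have := hS (C b) (C c) (C_ne_zero.2 hb) fun y hy => by
        rw [C_dvd_iff_dvd_coeff]
        intro i
        obtain ⟨j, hj⟩ := hcoeff y hy i
        rw [coeff_C_mul, ← hj]
        exact hbc j
      rw [mul_one, C_dvd_iff_dvd_coeff] at this
      simpa using this 0
    -- if `g = 0` then all members of `S` vanish, and `X` would divide `1`
    have hg0 : g ≠ 0 := by
      rintro rfl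
      refine not_isUnit_X (R := R) (isUnit_iff_dvd_one.2 ?_)
      have := hS X 1 X_ne_zero fun y hy => by
        have hy0 : y = 0 := by
          ext i
          obtain ⟨j, hj⟩ := hcoeff y hy i
          simpa using hj.symm
        simp [hy0]
      rwa [one_mul] at this
    have hgK : g.map (algebraMap R K) ≠ 0 := by
      rwa [Ne, Polynomial.map_eq_zero_iff (IsFractionRing.injective R K)]
    obtain ⟨Q, hQ, hQN⟩ := exists_isUpperToZero_le (K := K) hmax.prop.1 hgK fun x hx => by
      rw [Ideal.mem_comap, Ideal.mem_span_singleton, coe_mapRingHom] at hx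
      exact N.mem_of_dvd (dvd_of_map_dvd_map hcont hx) hgN
    have hQmax : Maximal s.IsStarPrime Q := h Q hQ
    rw [← hQmax.eq_of_le hmax.prop hQN]
    exact hQ.isStarPrime_tOperation.2
  · obtain ⟨P, hP, hJP⟩ := hs.exists_le_mem_starMax (hs.isStarIdeal_of_tOperation hJ) hJtop
    have hPN : P ≤ N := hmax.le_of_ge hP.prop (hNJ.trans hJP)
    rwa [le_antisymm hNJ (hJP.trans hPN)]

end UpperToZero

theorem theorem2p9 {R K L : Type*} [CommRing R] [IsDomain R]
    [Field K] [Algebra R K] [IsFractionRing R K]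
    [Field L] [Algebra R[X] L] [IsFractionRing R[X] L]
    (s : StarOperation R[X] L) (hs : s.IsFiniteCharacter) :
    (∀ Q : Ideal R[X], IsUpperToZero K Q → Q ∈ s.starMax) ↔
      (IsUMTDomain R K L ∧ (StarOperation.tOperation R[X] L).starMax = s.starMax) := by
  refine ⟨fun h => ⟨fun Q hQ => ?_, ?_⟩, fun ⟨hUMT, heq⟩ Q hQ => heq ▸ hUMT Q hQ⟩
  · have hQmax : Maximal s.IsStarPrime Q := h Q hQ
    exact ⟨hQ.isStarPrime_tOperation, fun P hP hle =>
      hQmax.le_of_ge ⟨hP.1, hs.isStarIdeal_of_tOperation hP.2⟩ hle⟩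
  · have hsub : s.starMax ⊆ (StarOperation.tOperation R[X] L).starMax := fun N hN =>
      ⟨⟨hN.prop.1, isStarIdeal_tOperation_of_mem_starMax hs h hN⟩, fun P hP hle =>
        hN.le_of_ge ⟨hP.1, hs.isStarIdeal_of_tOperation hP.2⟩ hle⟩
    refine Set.Subset.antisymm (fun M hM => ?_) hsub
    have hM' : Maximal (StarOperation.tOperation R[X] L).IsStarPrime M := hM
    obtain ⟨N, hN, hMN⟩ := hs.exists_le_mem_starMax
      (hs.isStarIdeal_of_tOperation hM'.prop.2) hM'.prop.1.ne_top
    rwa [hM'.eq_of_le (hsub hN).prop hMN]
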